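/- Let $\mathbb{F}_q$ be a finite field with primitive element $\xi$, let $m\ge 1$ and $1\le d\le m(q-1)$, and write $d-1=\nu(q-1)+\mu$ with $0\le\mu<q-1$. **Codes.** Let $P^m\subset\mathbb{F}_q^{m+1}$ be the set of vectors whose leftmost nonzero coordinate is $1$, so that $P^m=(\{1\}\times\mathbb{F}_q^m)\cup(\{0\}\times P^{m-1})$ and $P^0=\{1\}$. Let $\mathrm{ev}^{\mathbb{P}}_m$ and $\mathrm{ev}^{\mathbb{A}}_j$ denote evaluation of a polynomial at all points of $P^m$ and of $\mathbb{F}_q^j$, respectively, and put $$\mathrm{PRM}_d(m)=\mathrm{ev}^{\mathbb{P}}_m(\mathbb{F}_q[x_0,\dots,x_m]_d),\qquad \mathrm{RM}_d(j)=\mathrm{ev}^{\mathbb{A}}_j(\mathbb{F}_q[x_1,\dots,x_j]_{\le d}).$$ Here $\mathbb{F}_q[x_0,\dots,x_m]_d$ is the space of homogeneous polynomials of degree $d$ (including $0$). A vector $r$ indexed by $P^m$ is written $r=(r_1,r_2)$, where $r_1$ is its part on $\{1\}\times\mathbb{F}_q^m$ and $r_2$ its part on $\{0\}\times P^{m-1}$.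 Write $\mathrm{wt}(e)$ for the Hamming weight of a vector $e$, and $\mathrm{wt}(C)$ for the minimum distance of a code $C$. Put $$\eta_d(m)=\sum_{i=0}^{m-\nu-1}\mathrm{wt}(\mathrm{RM}_d(m-i))+1 .$$ For a vector $v$ indexed by $P^{m-1}$, let $v_{\xi,d}$ be the vector indexed by $\mathbb{F}_q^m$ with value $\xi^{rd}v_P$ at $\xi^rP$ ($P\in P^{m-1}$, $0\le r\le q-2$) and value $0$ at the origin. **Polynomials.** For $f$ of degree at most $d$ in $x_1,\dots,x_m$ let $h_d(f)=x_0^d f(x_1/x_0,\dots,x_m/x_0)$. A monomial $x^\alpha$ is bad if $0<|\alpha|<d$ and $|\alpha|\equiv d \bmod (q-1)$; $f_{bad}$ is the sum of the bad terms of $f$, $f_{good}=f-f_{bad}$, and $(f_{good})_d$ is the degree-$d$ part of $f_{good}$. For $f$ homogeneous of degree $d'$, where $0<d'<d$ and $d'\equiv d\bmod (q-1)$, let $(f)_d$ be obtained by multiplying each of its monomials by the $(d-d')$-th power of the first variable occurring in it. By $f \bmod I(\mathbb{A}^m)$ we mean the representative, with all exponents at most $q-1$, of the class of $f$ modulo $I(\mathbb{A}^m)=\langle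 x_i^q-x_i : 1\le i\le m\rangle$. **Affine decoders.** For $1\le j\le m$ and $0\le d'\le \min(d,j(q-1))$ let $D^{\mathbb{A}}_{d'}(j)$ be a decoder for $\mathrm{RM}_{d'}(j)$. On every input it returns either an error or a pair $(c,f)$ with $f\in\mathbb{F}_q[x_1,\dots,x_j]_{\le d'}$ and $c=\mathrm{ev}^{\mathbb{A}}_j(f)$. It corrects up to the error correction capability: on input $c+e$ with $c\in \mathrm{RM}_{d'}(j)$ and $\mathrm{wt}(e)<\mathrm{wt}(\mathrm{RM}_{d'}(j))/2$ it returns a pair with first entry $c$. **Algorithm $D^{\mathbb{P}}_d(m)$**, on input a vector $r$ indexed by $P^m$. For $m=0$, return $(r,rx_0^d)$. For $m\ge1$ let $t=\mathrm{wt}(\mathrm{PRM}_d(m))/2$. 1. If $t\le 1$, compute a homogeneous $f$ of degree $d$ with $\mathrm{ev}^{\mathbb{P}}_m(f)=r$ and return $(r,f)$ (an error, if there is no such $f$). 2. Otherwise, unless $D^{\mathbb{A}}_d(m)(r_1)$ is an error, let $(c_1,f^0)=D^{\mathbb{A}}_d(m)(r_1)$. - If $d\le q-1$, put $f=h_d(f^0)$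 and $c=\mathrm{ev}^{\mathbb{P}}_m(f)$. If $\mathrm{wt}(r-c)<t$, return $(c,f)$. - If $d\ge q$, put $c_{good}=\mathrm{ev}^{\mathbb{P}}_{m-1}((f^0_{good})_d)$, where polynomials on $P^{m-1}$ are written in the variables $x_1,\dots,x_m$. Unless $D^{\mathbb{P}}_{d-(q-1)}(m-1)(r_2-c_{good})$ is an error, call its answer $(c_{bad},f'_{bad})$, and put $g^0=f^0-f'_{bad}-(f^0_{good})_d \bmod I(\mathbb{A}^m)$, $f=h_d(g^0)+(f'_{bad})_d+(f^0_{good})_d$ and $c=(c_1,c_{good}+c_{bad})$. If $\mathrm{wt}(r-c)<t$, return $(c,f)$. 3. If step 2 has not returned, let $(v,g)=D^{\mathbb{P}}_d(m-1)(r_2)$ and $(u,f^0_{\le d-1})=D^{\mathbb{A}}_{d-1}(m)(r_1-v_{\xi,d})$, and return $\big((u+v_{\xi,d},v),\,h_d(f^0_{\le d-1})+g\big)$ (an error, if one of the two calls gives an error). **Theorem.** If $r=c+e$ with $c\in\mathrm{PRM}_d(m)$ and $\mathrm{wt}(e)<\eta_d(m)/2$, then the algorithm $D^{\mathbb{P}}_d(m)$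 on input $r$ returns $(c,f)$, where $f\in\mathbb{F}_q[x_0,\dots,x_m]_d$ is a homogeneous polynomial of degree $d$ with $\mathrm{ev}^{\mathbb{P}}_m(f)=c$. -/

import Mathlib

open MvPolynomial

namespace PRMDecoding

/-- `Q` is the standard representative of a projective point: its leftmost nonzero coordinate
is equal to `1`. -/
def IsStd {K : Type*} [Field K] {n : ℕ} (Q : Fin n → K) : Prop :=
  ∃ i, Q i = 1 ∧ ∀ j < i, Q j = 0

instance {K : Type*} [Field K] [DecidableEq K] {n : ℕ} :
    DecidablePred (IsStd : (Fin n → K) → Prop) :=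
  fun Q => inferInstanceAs (Decidable (∃ i, Q i = 1 ∧ ∀ j < i, Q j = 0))

/-- The set `P^m` of standard representatives of the points of projective `m`-space. -/
abbrev ProjPt (K : Type*) [Field K] (m : ℕ) : Type _ := {Q : Fin (m + 1) → K // IsStd Q}

theorem isStd_cons_one {K : Type*} [Field K] {n : ℕ} (Q : Fin n → K) :
    IsStd (Fin.cons 1 Q : Fin (n + 1) → K) :=
  ⟨0, rfl, fun j hj => absurd hj (Fin.not_lt_zero j)⟩

theorem isStd_cons_zero {K : Type*} [Field K] {n : ℕ} {Q : Fin n → K} (h : IsStd Q) :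
    IsStd (Fin.cons 0 Q : Fin (n + 1) → K) := by
  obtain ⟨i, hi, hj⟩ := h
  refine ⟨i.succ, by simpa using hi, fun j hji => ?_⟩
  induction j using Fin.cases with
  | zero => rfl
  | succ j => simpa using hj j (Fin.succ_lt_succ_iff.mp hji)

theorem isStd_tail {K : Type*} [Field K] {n : ℕ} {Q : Fin (n + 1) → K} (h : IsStd Q)
    (h0 : Q 0 ≠ 1) : IsStd (Fin.tail Q) := by
  obtain ⟨i, hi, hj⟩ := h
  induction i using Fin.cases with
  | zero => exact absurd hi h0
  | succ i => exact ⟨i, hi, fun j hji => hj j.succ (Fin.succ_lt_succ_iff.mpr hji)⟩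

/-- Vectors of `K^(q^j)`, with coordinates labelled by the points of the affine space `K^j`. -/
abbrev AffWord (K : Type*) (j : ℕ) : Type _ := (Fin j → K) → K

/-- Vectors of `K^(p_m)`, with coordinates labelled by the points of `P^m`. -/
abbrev ProjWord (K : Type*) [Field K] (m : ℕ) : Type _ := ProjPt K m → K

/-- The part `r₁` of `r = (r₁, r₂)`: the coordinates at the points of `{1} × K^(m+1)`. -/
def affPart {K : Type*} [Field K] {m : ℕ} (r : ProjWord K (m + 1)) : AffWord K (m + 1) :=
  fun Q => r ⟨Fin.cons 1 Q, isStd_cons_one Q⟩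

/-- The part `r₂` of `r = (r₁, r₂)`: the coordinates at the points of `{0} × P^m`. -/
def infPart {K : Type*} [Field K] {m : ℕ} (r : ProjWord K (m + 1)) : ProjWord K m :=
  fun Q => r ⟨Fin.cons 0 Q.1, isStd_cons_zero Q.2⟩

/-- The vector `(c₁, c₂)` with parts `c₁` on `{1} × K^(m+1)` and `c₂` on `{0} × P^m`. -/
def glue {K : Type*} [Field K] [DecidableEq K] {m : ℕ} (c₁ : AffWord K (m + 1))
    (c₂ : ProjWord K m) : ProjWord K (m + 1) :=
  fun Q => if h : Q.1 0 = 1 then c₁ (Fin.tail Q.1) else c₂ ⟨Fin.tail Q.1, isStd_tail Q.2 h⟩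

/-- Evaluation of a polynomial at all the points of `K^j`. -/
noncomputable def evA {K : Type*} [Field K] {j : ℕ} (f : MvPolynomial (Fin j) K) : AffWord K j :=
  fun Q => eval Q f

/-- Evaluation of a polynomial at all the points of `P^m`. -/
noncomputable def evP {K : Type*} [Field K] {m : ℕ} (f : MvPolynomial (Fin (m + 1)) K) :
    ProjWord K m :=
  fun Q => eval Q.1 f

/-- The affine Reed-Muller code of degree `d` in `j` variables. -/
def RM (K : Type*) [Field K] (d j : ℕ) : Set (AffWord K j) :=
  evA '' {f : MvPolynomial (Fin j) K | f.totalDegree ≤ d}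

/-- The projective Reed-Muller code of degree `d` over `P^m`. -/
def PRM (K : Type*) [Field K] (d m : ℕ) : Set (ProjWord K m) :=
  evP '' {f : MvPolynomial (Fin (m + 1)) K | f.IsHomogeneous d}

/-- The minimum distance `wt(C)` of a nonzero linear code `C`: the least Hamming weight of a
nonzero codeword. -/
noncomputable def minDist {K ι : Type*} [Field K] [DecidableEq K] [Fintype ι]
    (C : Set (ι → K)) : ℕ :=
  sInf {w | ∃ c ∈ C, c ≠ 0 ∧ hammingNorm c = w}

/-- `η_d(m) = ∑_{i=0}^{m-ν-1} wt(RM_d(m-i)) + 1`, for `d - 1 = ν (q - 1) + μ`, `0 ≤ μ < q - 1`. -/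
noncomputable def eta (K : Type*) [Field K] [Fintype K] [DecidableEq K] (ν d m : ℕ) : ℕ :=
  (∑ i ∈ Finset.range (m - ν), minDist (RM K d (m - i))) + 1

/-- `D` is a decoder for `RM_d(j)` that corrects up to the error correction capability.
An input is answered by an error (`none`) or by a codeword together with a polynomial of degree
at most `d` whose evaluation is that codeword; and the answer to `c + e`, for a codeword `c` and
`wt(e) < wt(RM_d(j)) / 2`, is `c` with such a polynomial. -/
def IsRMDecoder {K : Type*} [Field K] [Fintype K] [DecidableEq K] (d j : ℕ)
    (D : AffWord K j → Option (AffWord K j × MvPolynomial (Fin j) K)) : Prop :=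
  (∀ r c f, D r = some (c, f) → f.totalDegree ≤ d ∧ evA f = c) ∧
  (∀ c ∈ RM K d j, ∀ e : AffWord K j,
    (hammingNorm e : ℚ) < (minDist (RM K d j) : ℚ) / 2 → ∃ f, D (c + e) = some (c, f))

/-- `v_{ξ,d} = v × ξ^d v × ⋯ × ξ^((q-2)d) v × {0}`: the vector on `K^(m+1)` with value
`ξ^(rd) v_P` at the point `ξ^r P`, for `0 ≤ r ≤ q - 2` and `P ∈ P^m`, and value `0` at the
origin. (The points `ξ^r P` are pairwise distinct, so at most one term of the sum is nonzero.) -/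
noncomputable def twist {K : Type*} [Field K] [Fintype K] [DecidableEq K] {m : ℕ} (ξ : K) (d : ℕ)
    (v : ProjWord K m) : AffWord K (m + 1) :=
  fun Q => ∑ r ∈ Finset.range (Fintype.card K - 1), ∑ P : ProjPt K m,
    if ξ ^ r • P.1 = Q then ξ ^ (r * d) * v P else 0

/-- Homogenization `x₀^d f(x₁/x₀, …, xₙ/x₀)` of a polynomial of degree at most `d` in
`x₁, …, xₙ`. -/
noncomputable def homog {K : Type*} [Field K] {n : ℕ} (d : ℕ) (f : MvPolynomial (Fin n) K) :
    MvPolynomial (Fin (n + 1)) K :=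
  ∑ α ∈ f.support, monomial (Finsupp.cons (d - α.degree) α) (coeff α f)

/-- A monomial `x^α` is bad if `0 < |α| < d` and `|α| ≡ d mod (q - 1)`. -/
abbrev IsBad (q d : ℕ) {n : ℕ} (α : Fin n →₀ ℕ) : Prop :=
  0 < α.degree ∧ α.degree < d ∧ α.degree ≡ d [MOD q - 1]

/-- The sum `f_bad` of the terms of `f` corresponding to bad monomials. -/
noncomputable def badPart {K : Type*} [Field K] [Fintype K] {n : ℕ} (d : ℕ)
    (f : MvPolynomial (Fin n) K) : MvPolynomial (Fin n) K :=
  ∑ α ∈ f.support with IsBad (Fintype.card K) d α, monomial α (coeff α f)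

/-- `f_good = f - f_bad`. -/
noncomputable def goodPart {K : Type*} [Field K] [Fintype K] {n : ℕ} (d : ℕ)
    (f : MvPolynomial (Fin n) K) : MvPolynomial (Fin n) K :=
  f - badPart d f

/-- Reduction modulo the vanishing ideal `⟨x_i^q - x_i⟩` of affine space: every exponent `a > 0`
is replaced by the exponent in `{1, …, q - 1}` congruent to `a` modulo `q - 1`. -/
noncomputable def reduce {K : Type*} [Field K] [Fintype K] {n : ℕ} (f : MvPolynomial (Fin n) K) :
    MvPolynomial (Fin n) K :=
  ∑ α ∈ f.support, monomial
    (α.mapRange (fun a => if a = 0 then 0 else (a - 1) % (Fintype.card K - 1) + 1) (if_pos rfl))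
    (coeff α f)

/-- Raising of a polynomial to degree `d`: in each monomial `x^α` (other than `1`), the exponent
of the first variable that occurs is increased by `d - |α|`. -/
noncomputable def raise {K : Type*} [Field K] {n : ℕ} (d : ℕ) (f : MvPolynomial (Fin n) K) :
    MvPolynomial (Fin n) K :=
  ∑ α ∈ f.support, monomial
    (if h : α.support.Nonempty then α + Finsupp.single (α.support.min' h) (d - α.degree) else α)
    (coeff α f)

/-- The type of the answers of a decoder for a code over `P^m`: an error (`none`), or a vector
and a polynomial. -/
abbrev ProjAnswer (K : Type*) [Field K] (m : ℕ) : Type _ :=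
  Option (ProjWord K m × MvPolynomial (Fin (m + 1)) K)

open Classical in
/-- Compute a homogeneous polynomial `f` of degree `d` whose evaluation over `P^m` is `r`, and
return `(r, f)`; return an error if there is no such `f`. -/
noncomputable def solve {K : Type*} [Field K] {m : ℕ} (d : ℕ) (r : ProjWord K m) :
    ProjAnswer K m :=
  if h : ∃ f : MvPolynomial (Fin (m + 1)) K, f.IsHomogeneous d ∧ evP f = r then
    some (r, h.choose)
  else none

/-- First part of the algorithm, over `P^(m+1)`, with affine decoders `DA d j` and with the
decoders `DP d` over `P^m`. The answer `none` means that this part did not return. -/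
noncomputable def firstPart {K : Type*} [Field K] [Fintype K] [DecidableEq K]
    (DA : (d j : ℕ) → AffWord K j → Option (AffWord K j × MvPolynomial (Fin j) K))
    {m : ℕ} (DP : ℕ → ProjWord K m → ProjAnswer K m) (d : ℕ) (r : ProjWord K (m + 1)) :
    ProjAnswer K (m + 1) :=
  let t : ℚ := (minDist (PRM K d (m + 1)) : ℚ) / 2
  match DA d (m + 1) (affPart r) with
  | none => none
  | some (c₁, f₀) =>
    if d ≤ Fintype.card K - 1 then
      let f := homog d f₀
      let c := evP f
      if (hammingNorm (r - c) : ℚ) < t then some (c, f) else none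
    else
      let fgood := homogeneousComponent d (goodPart d f₀)
      let cgood : ProjWord K m := evP fgood
      match DP (d - (Fintype.card K - 1)) (infPart r - cgood) with
      | none => none
      | some (cbad, fbad) =>
        let g₀ := reduce (f₀ - fbad - fgood)
        let f := homog d g₀ + rename Fin.succ (raise d fbad) + rename Fin.succ fgood
        let c := glue c₁ (cgood + cbad)
        if (hammingNorm (r - c) : ℚ) < t then some (c, f) else none

/-- Second part of the algorithm. -/
noncomputable def secondPart {K : Type*} [Field K] [Fintype K] [DecidableEq K] (ξ : K)
    (DA : (d j : ℕ) → AffWord K j → Option (AffWord K j × MvPolynomial (Fin j) K))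
    {m : ℕ} (DP : ℕ → ProjWord K m → ProjAnswer K m) (d : ℕ) (r : ProjWord K (m + 1)) :
    ProjAnswer K (m + 1) :=
  match DP d (infPart r) with
  | none => none
  | some (v, g) =>
    match DA (d - 1) (m + 1) (affPart r - twist ξ d v) with
    | none => none
    | some (u, f₀) => some (glue (u + twist ξ d v) v, homog d f₀ + rename Fin.succ g)

/-- The recursive decoding algorithm for the projective Reed-Muller codes: the answer of the
decoder for `PRM_d(m)`, built on the decoders `DA d j` for the affine codes `RM_d(j)`, to the
received word `r`. -/
noncomputable def decode {K : Type*} [Field K] [Fintype K] [DecidableEq K] (ξ : K)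
    (DA : (d j : ℕ) → AffWord K j → Option (AffWord K j × MvPolynomial (Fin j) K)) :
    (m d : ℕ) → ProjWord K m → ProjAnswer K m
  | 0, d, r => some (r, C (r ⟨fun _ => 1, 0, rfl, fun j hj => absurd hj (Fin.not_lt_zero j)⟩)
      * X 0 ^ d)
  | m + 1, d, r =>
    if (minDist (PRM K d (m + 1)) : ℚ) / 2 ≤ 1 then solve d r
    else
      match firstPart DA (decode ξ DA m) d r with
      | some out => some out
      | none => secondPart ξ DA (decode ξ DA m) d r

end PRMDecoding

/-! Let q be the field size and split e = (e₁, e₂) in the same way as r. Two statements are proved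
by induction on m: every answer of `decode` is a pair (ev f, f) with f a form of degree d
(`decode_sound`), and every error with 2 wt(e) < η_d(m) is corrected (`exists_decode_eq_some`).

If d ≤ m(q - 1), then η_d(m) = wt(RM_d(m)) + η_d(m - 1), so 2 wt(e₁) < wt(RM_d(m)) or 2 wt(e₂) <
η_d(m - 1). In the first case the affine decoder finds c₁ = ev(f⁰), but f⁰ may differ from a
dehomogenization f belonging to c. The difference vanishes on affine space. For d ≤ q - 1 it is
therefore zero. For d ≥ q its leading form takes the values of a form of degree d - (q - 1)
(`exists_lower_form_of_evA_eq_zero`), so that c₂ - c_good lies in PRM_{d-(q-1)}(m - 1). The bound η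
of that code equals η_d(m) (`eta_succ_succ`), so the recursive call succeeds and step 2 returns.

Hence, if step 2 does not return, the second case holds and c₂ is found recursively. The twist of c₂
is the evaluation of the leading form on affine space (`twist_evP`). Subtracting it from c₁ leaves a
word of RM_{d-1}(m), whose minimum distance is at least η_d(m) (`eta_le_minDist_RM`). If step 2 does
return, its output is a codeword at distance less than wt(PRM_d(m))/2 from r; since η_d(m) ≤
wt(PRM_d(m)) (`eta_le_minDist_PRM`), it is c. -/

namespace PRMDecoding

/-! ### Homogenization, leading forms and raising of degrees -/

section Polynomials

variable {K : Type*} [Field K] {n d : ℕ}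

theorem eval_homog_cons_one (f : MvPolynomial (Fin n) K) (Q : Fin n → K) :
    eval (Fin.cons 1 Q : Fin (n + 1) → K) (homog d f) = eval Q f := by
  rw [homog, map_sum, eval_eq']
  refine Finset.sum_congr rfl fun α _ => ?_
  rw [eval_monomial, Finsupp.prod_fintype _ _ (fun i => pow_zero _), Fin.prod_univ_succ]
  simp

theorem eval_homogeneousComponent (f : MvPolynomial (Fin n) K) (Q : Fin n → K) :
    eval Q (homogeneousComponent d f) =
      ∑ α ∈ f.support, if α.degree = d then coeff α f * ∏ i, Q i ^ α i else 0 := by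
  rw [homogeneousComponent_apply, map_sum, Finset.sum_filter]
  refine Finset.sum_congr rfl fun α _ => ?_
  rw [eval_monomial, Finsupp.prod_fintype _ _ (fun i => pow_zero _)]

theorem eval_homog_cons_zero {f : MvPolynomial (Fin n) K} (hf : f.totalDegree ≤ d)
    (Q : Fin n → K) :
    eval (Fin.cons 0 Q : Fin (n + 1) → K) (homog d f) = eval Q (homogeneousComponent d f) := by
  rw [homog, map_sum, eval_homogeneousComponent]
  refine Finset.sum_congr rfl fun α hα => ?_
  have hle : α.degree ≤ d := (le_totalDegree hα).trans hf
  rw [eval_monomial, Finsupp.prod_fintype _ _ (fun i => pow_zero _), Fin.prod_univ_succ]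
  simp only [Finsupp.cons_zero, Fin.cons_zero, Finsupp.cons_succ, Fin.cons_succ]
  split_ifs with h
  · simp [h]
  · rw [zero_pow (by omega)]; simp

theorem isHomogeneous_homog {f : MvPolynomial (Fin n) K} (hf : f.totalDegree ≤ d) :
    (homog d f).IsHomogeneous d := by
  refine IsHomogeneous.sum _ _ _ fun α hα => isHomogeneous_monomial _ ?_
  have hle : α.degree ≤ d := (le_totalDegree hα).trans hf
  rw [Finsupp.degree_eq_sum] at hle ⊢
  rw [Fin.sum_univ_succ]
  simp only [Finsupp.cons_zero, Finsupp.cons_succ]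
  rw [Finsupp.degree_eq_sum]
  omega

theorem eval_smul_of_isHomogeneous {f : MvPolynomial (Fin n) K} (hf : f.IsHomogeneous d)
    (a : K) (Q : Fin n → K) : eval (a • Q) f = a ^ d * eval Q f := by
  rw [eval_eq', eval_eq', Finset.mul_sum]
  refine Finset.sum_congr rfl fun α hα => ?_
  have : α.degree = d := by
    by_contra h
    exact (mem_support_iff.1 hα) (hf.coeff_eq_zero h)
  rw [← this, Finsupp.degree_eq_sum, ← Finset.prod_pow_eq_pow_sum]
  simp only [Pi.smul_apply, smul_eq_mul, mul_pow, Finset.prod_mul_distrib]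
  ring

theorem eval_zero_of_isHomogeneous {f : MvPolynomial (Fin n) K} (hf : f.IsHomogeneous d)
    (hd : d ≠ 0) : eval (0 : Fin n → K) f = 0 := by
  have := eval_smul_of_isHomogeneous hf 0 0
  rwa [zero_smul, zero_pow hd, zero_mul] at this

/-- Dehomogenization of a form, on the level of values. -/
theorem exists_dehomogenization {F : MvPolynomial (Fin (n + 1)) K} (hF : F.IsHomogeneous d) :
    ∃ f : MvPolynomial (Fin n) K, f.totalDegree ≤ d ∧
      (∀ Q, eval (Fin.cons 1 Q : Fin (n + 1) → K) F = eval Q f) ∧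
      ∀ Q, eval (Fin.cons 0 Q : Fin (n + 1) → K) F = eval Q (homogeneousComponent d f) := by
  have hdeg : ∀ β ∈ F.support, β 0 + β.tail.degree = d := fun β hβ => by
    have : β.degree = d := by
      by_contra h
      exact (mem_support_iff.1 hβ) (hF.coeff_eq_zero h)
    rw [← this, Finsupp.degree_eq_sum, Finsupp.degree_eq_sum, Fin.sum_univ_succ]
    simp [Finsupp.tail_apply]
  refine ⟨∑ β ∈ F.support, monomial β.tail (coeff β F), ?_, fun Q => ?_, fun Q => ?_⟩
  · refine totalDegree_finsetSum_le fun β hβ => (totalDegree_monomial_le _ _).trans ?_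
    have := hdeg β hβ
    change β.tail.degree ≤ d
    omega
  · rw [eval_eq', map_sum]
    refine Finset.sum_congr rfl fun β _ => ?_
    rw [eval_monomial, Finsupp.prod_fintype _ _ (fun i => pow_zero _), Fin.prod_univ_succ]
    simp [Finsupp.tail_apply]
  · rw [eval_eq', map_sum, map_sum]
    refine Finset.sum_congr rfl fun β hβ => ?_
    have h := hdeg β hβ
    rw [Fin.prod_univ_succ]
    simp only [Fin.cons_zero, Fin.cons_succ]
    by_cases h0 : β 0 = 0
    · rw [homogeneousComponent_eq_self (isHomogeneous_monomial _ (by omega)), eval_monomial,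
        Finsupp.prod_fintype _ _ (fun i => pow_zero _)]
      simp [h0, Finsupp.tail_apply]
    · rw [zero_pow h0, zero_mul, mul_zero, homogeneousComponent_eq_zero, map_zero]
      refine (totalDegree_monomial_le _ _).trans_lt ?_
      change β.tail.degree < d
      omega

theorem totalDegree_sub_homogeneousComponent_lt {f : MvPolynomial (Fin n) K}
    (hf : f.totalDegree ≤ d) (hd : 0 < d) :
    (f - homogeneousComponent d f).totalDegree < d := by
  rw [totalDegree, Finset.sup_lt_iff (by simpa using hd)]
  intro α hα
  change α.degree < d
  rw [mem_support_iff, coeff_sub, coeff_homogeneousComponent] at hα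
  split_ifs at hα with h
  · simp at hα
  · rw [sub_zero] at hα
    exact lt_of_le_of_ne ((le_totalDegree (mem_support_iff.2 hα)).trans hf) h

theorem mem_restrictDegree_of_totalDegree_le {f : MvPolynomial (Fin n) K}
    (hf : f.totalDegree ≤ d) : f ∈ restrictDegree (Fin n) K d := by
  rw [mem_restrictDegree]
  exact fun s hs i => (Finsupp.le_degree i s).trans ((le_totalDegree hs).trans hf)

theorem degree_add_single_min' {α : Fin n →₀ ℕ} (h : α.support.Nonempty) (hα : α.degree ≤ d) :
    (α + Finsupp.single (α.support.min' h) (d - α.degree)).degree = d := by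
  rw [map_add, Finsupp.degree_single]
  omega

theorem isHomogeneous_raise {d' : ℕ} {f : MvPolynomial (Fin n) K} (hf : f.IsHomogeneous d')
    (hd' : 0 < d') (hle : d' ≤ d) : (raise d f).IsHomogeneous d := by
  refine IsHomogeneous.sum _ _ _ fun α hα => isHomogeneous_monomial _ ?_
  have hdeg : α.degree = d' := by
    by_contra h
    exact (mem_support_iff.1 hα) (hf.coeff_eq_zero h)
  have hne : α.support.Nonempty := by
    rw [Finsupp.support_nonempty_iff]
    rintro rfl
    simp at hdeg
    omega
  rw [dif_pos hne, degree_add_single_min' hne (by omega)]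

theorem homogeneousComponent_mul_left {k j : ℕ} {a : MvPolynomial (Fin n) K}
    (ha : a.IsHomogeneous k) (f : MvPolynomial (Fin n) K) :
    homogeneousComponent (k + j) (a * f) = a * homogeneousComponent j f := by
  have key : ∀ i, homogeneousComponent (k + j) (a * homogeneousComponent i f) =
      if i = j then a * homogeneousComponent j f else 0 := fun i => by
    rw [homogeneousComponent_of_mem (ha.mul (homogeneousComponent_isHomogeneous i f))]
    by_cases h : i = j
    · simp [h]
    · rw [if_neg (by omega), if_neg h]
  conv_lhs => rw [← sum_homogeneousComponent f]
  rw [Finset.mul_sum, map_sum, Finset.sum_congr rfl fun i _ => key i, Finset.sum_ite_eq']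
  split_ifs with h
  · rfl
  · rw [homogeneousComponent_eq_zero j f (by simpa using h), mul_zero]

theorem X_sub_C_ne_zero (i : Fin n) (s : K) : (X i - C s : MvPolynomial (Fin n) K) ≠ 0 := by
  intro h
  have := congrArg (eval fun _ => s + 1) h
  simp at this

end Polynomials

/-! ### Polynomial functions on affine space over a finite field -/

section FiniteFields

variable {K : Type*} [Field K] [Fintype K] {n d : ℕ}

theorem homogeneousComponent_badPart (f : MvPolynomial (Fin n) K) :
    homogeneousComponent d (badPart d f) = 0 := by
  rw [badPart, map_sum]
  refine Finset.sum_eq_zero fun α hα => homogeneousComponent_eq_zero _ _ ?_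
  exact (totalDegree_monomial_le _ _).trans_lt (Finset.mem_filter.1 hα).2.2.1

/-- Bad monomials have degree below d, so (f_good)_d is simply the leading form of f. -/
theorem homogeneousComponent_goodPart (f : MvPolynomial (Fin n) K) :
    homogeneousComponent d (goodPart d f) = homogeneousComponent d f := by
  rw [goodPart, map_sub, homogeneousComponent_badPart, sub_zero]

theorem pow_reduced (x : K) {a : ℕ} (ha : a ≠ 0) :
    x ^ ((a - 1) % (Fintype.card K - 1) + 1) = x ^ a := by
  obtain ⟨b, rfl⟩ := Nat.exists_eq_succ_of_ne_zero ha
  rcases eq_or_ne x 0 with rfl | hx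
  · simp
  · rw [Nat.succ_sub_one, pow_succ, pow_succ,
      ← pow_eq_pow_mod b (FiniteField.pow_card_sub_one_eq_one x hx)]

theorem evA_reduce (f : MvPolynomial (Fin n) K) : evA (reduce f) = evA f := by
  funext Q
  rw [evA, evA, reduce, map_sum, eval_eq']
  refine Finset.sum_congr rfl fun α _ => ?_
  rw [eval_monomial, Finsupp.prod_fintype _ _ (fun i => pow_zero _)]
  congr 1
  refine Finset.prod_congr rfl fun i _ => ?_
  rw [Finsupp.mapRange_apply]
  split_ifs with h
  · rw [h]
  · exact pow_reduced _ h

theorem totalDegree_reduce_le (f : MvPolynomial (Fin n) K) :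
    (reduce f).totalDegree ≤ f.totalDegree := by
  refine totalDegree_finsetSum_le fun α hα => (totalDegree_monomial_le _ _).trans ?_
  refine le_trans ?_ (le_totalDegree hα)
  change Finsupp.degree _ ≤ Finsupp.degree _
  rw [Finsupp.degree_eq_sum, Finsupp.degree_eq_sum]
  refine Finset.sum_le_sum fun i _ => ?_
  rw [Finsupp.mapRange_apply]
  split_ifs with h
  · exact Nat.zero_le _
  · have := Nat.mod_le (α i - 1) (Fintype.card K - 1)
    omega

theorem reduce_mem_restrictDegree (f : MvPolynomial (Fin n) K) :
    reduce f ∈ restrictDegree (Fin n) K (Fintype.card K - 1) := by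
  have hq : 1 < Fintype.card K := Fintype.one_lt_card
  refine Submodule.sum_mem _ fun α _ => ?_
  rw [mem_restrictDegree]
  intro s hs i
  rw [Finset.mem_singleton.1 (support_monomial_subset hs), Finsupp.mapRange_apply]
  split_ifs
  · exact Nat.zero_le _
  · have := Nat.mod_lt (α i - 1) (show 0 < Fintype.card K - 1 by omega)
    omega

theorem eq_zero_of_evA_eq_zero {f : MvPolynomial (Fin n) K}
    (hf : f ∈ restrictDegree (Fin n) K (Fintype.card K - 1)) (h : evA f = 0) : f = 0 := by
  have hq : 0 < Fintype.card K := Fintype.card_pos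
  refine eq_zero_of_eval_zero_at_prod_finset f (fun _ => Finset.univ) (fun i => ?_)
    (fun x _ => congrFun h x)
  have : degreeOf i f ≤ Fintype.card K - 1 :=
    degreeOf_le_iff.2 fun s hs => (mem_restrictDegree _ _ _).1 hf s hs i
  rw [Finset.card_univ]
  omega

/-- Only an exponent that is already positive grows, and it grows by q - 1: the factor is 1 at
nonzero coordinates, and at a zero coordinate the monomial vanishes before and after. -/
theorem eval_raise {d' : ℕ} {f : MvPolynomial (Fin n) K} (hf : f.IsHomogeneous d')
    (hd : d = d' + (Fintype.card K - 1)) (Q : Fin n → K) :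
    eval Q (raise d f) = eval Q f := by
  rw [raise, map_sum, eval_eq']
  refine Finset.sum_congr rfl fun α hα => ?_
  have hdeg : α.degree = d' := by
    by_contra h
    exact (mem_support_iff.1 hα) (hf.coeff_eq_zero h)
  rw [eval_monomial, Finsupp.prod_fintype _ _ (fun i => pow_zero _)]
  congr 1
  refine Finset.prod_congr rfl fun i _ => ?_
  split_ifs with h
  · rw [Finsupp.add_apply, Finsupp.single_apply]
    split_ifs with hi
    · subst hi
      have h0 : α (α.support.min' h) ≠ 0 := Finsupp.mem_support_iff.1 (Finset.min'_mem _ h)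
      have hs : d - α.degree = Fintype.card K - 1 := by omega
      rw [hs]
      rcases eq_or_ne (Q (α.support.min' h)) 0 with hQ | hQ
      · rw [hQ, zero_pow h0, zero_pow (by omega)]
      · rw [pow_add, FiniteField.pow_card_sub_one_eq_one _ hQ, mul_one]
    · rw [add_zero]
  · rfl

theorem prod_univ_X_sub_C (i : Fin n) : (∏ s : K, (X i - C s) : MvPolynomial (Fin n) K) =
    X i ^ Fintype.card K - X i := by
  have hq : 1 < Fintype.card K := Fintype.one_lt_card
  have hroots := FiniteField.roots_X_pow_card_sub_X K
  have h := Polynomial.prod_multiset_X_sub_C_of_monic_of_roots_card_eq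
    (p := (Polynomial.X ^ Fintype.card K - Polynomial.X : Polynomial K))
    (Polynomial.monic_X_pow_sub (by rw [Polynomial.degree_X]; exact_mod_cast hq))
    (by rw [hroots, FiniteField.X_pow_card_sub_X_natDegree_eq K hq]; rfl)
  rw [hroots] at h
  have := congrArg (Polynomial.aeval (X i : MvPolynomial (Fin n) K)) h
  simpa [map_prod, algebraMap_eq] using this

/-- A polynomial of degree at most `d` that vanishes on affine space has a leading form that
takes the values of a form of degree `d - (q - 1)`. -/
theorem exists_lower_form_of_evA_eq_zero {f : MvPolynomial (Fin n) K} (hf : f.totalDegree ≤ d)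
    (h0 : evA f = 0) (hd : Fintype.card K ≤ d) :
    ∃ g : MvPolynomial (Fin n) K, g.IsHomogeneous (d - (Fintype.card K - 1)) ∧
      evA g = evA (homogeneousComponent d f) := by
  have hq : 1 < Fintype.card K := Fintype.one_lt_card
  obtain ⟨h, hdeg, hfh⟩ := combinatorial_nullstellensatz_exists_linearCombination
    (fun _ : Fin n => (Finset.univ : Finset K)) (fun _ => Finset.univ_nonempty) f
    (fun x _ => congrFun h0 x)
  have hdegree : ∀ i, (h i).totalDegree ≤ d - Fintype.card K := fun i => by
    rcases eq_or_ne (h i) 0 with hi | hi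
    · simp [hi]
    have hne : (X i ^ Fintype.card K - X i : MvPolynomial (Fin n) K) ≠ 0 := by
      rw [← prod_univ_X_sub_C]
      exact Finset.prod_ne_zero_iff.2 fun s _ => X_sub_C_ne_zero i s
    have hX : (X i : MvPolynomial (Fin n) K).totalDegree = 1 := totalDegree_X i
    have hXq : (X i ^ Fintype.card K : MvPolynomial (Fin n) K).totalDegree = Fintype.card K :=
      totalDegree_X_pow i _
    have := hdeg i
    rw [prod_univ_X_sub_C, totalDegree_mul_of_isDomain hne hi, sub_eq_add_neg,
      totalDegree_add_eq_left_of_totalDegree_lt (by rw [totalDegree_neg]; omega), hXq] at this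
    omega
  -- With f = ∑ hᵢ(xᵢ^q - xᵢ) and deg hᵢ ≤ d - q, the degree-d part of f is ∑ xᵢ^q (hᵢ)_{d-q}.
  -- Replacing xᵢ^q by xᵢ keeps the values and lowers the degree by q - 1.
  refine ⟨∑ i, X i * homogeneousComponent (d - Fintype.card K) (h i),
    IsHomogeneous.sum _ _ _ fun i _ => ?_, ?_⟩
  · convert (isHomogeneous_X K i).mul (homogeneousComponent_isHomogeneous _ _) using 1
    omega
  · have hcomp : homogeneousComponent d f =
        ∑ i, X i ^ Fintype.card K * homogeneousComponent (d - Fintype.card K) (h i) := by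
      rw [hfh, Finsupp.linearCombination_apply, Finsupp.sum_fintype _ _ (by intro i; exact zero_smul _ _),
        map_sum]
      refine Finset.sum_congr rfl fun i _ => ?_
      have hlow : homogeneousComponent d (h i * X i) = 0 := by
        refine homogeneousComponent_eq_zero _ _ ((totalDegree_mul _ _).trans_lt ?_)
        have := hdegree i
        rw [totalDegree_X]
        omega
      rw [smul_eq_mul, prod_univ_X_sub_C, mul_sub, map_sub, hlow, sub_zero, mul_comm (h i),
        ← homogeneousComponent_mul_left (isHomogeneous_X_pow i _)]
      congr 2
      omega
    funext Q
    rw [hcomp, evA, evA, map_sum, map_sum]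
    refine Finset.sum_congr rfl fun i _ => ?_
    rw [eval_mul, eval_mul, eval_X, map_pow, eval_X, FiniteField.pow_card]

end FiniteFields

/-! ### Arithmetic of the affine minimum distance -/

/-- The minimum distance of the affine Reed-Muller code of degree `d` in `n` variables over a
field with `q` elements. -/
def affDist (q : ℕ) : ℕ → ℕ → ℕ
  | 0, _ => 1
  | n + 1, d => if d ≤ q - 1 then (q - d) * q ^ n else affDist q n (d - (q - 1))

theorem affDist_pos {q : ℕ} (hq : 1 < q) (n d : ℕ) : 0 < affDist q n d := by
  induction n generalizing d with
  | zero => exact Nat.one_pos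
  | succ n ih =>
    rw [affDist]
    split_ifs
    · exact Nat.mul_pos (by omega) (Nat.pow_pos (by omega))
    · exact ih _

/-- This is the numerical step of the induction on the number of variables: k is the degree in the
first variable, and d - k bounds the degree of its leading coefficient. -/
theorem affDist_succ_le {q : ℕ} (hq : 1 < q) (n : ℕ) :
    ∀ d k, k ≤ d → k ≤ q - 1 → affDist q (n + 1) d ≤ (q - k) * affDist q n (d - k) := by
  induction n with
  | zero =>
    intro d k hkd hkq
    rw [affDist, affDist]
    split_ifs
    · rw [pow_zero, mul_one, mul_one]; omega
    · rw [affDist, mul_one]; omega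
  | succ n ih =>
    intro d k hkd hkq
    rw [affDist]
    split_ifs with hd
    · rw [affDist, if_pos (by omega), pow_succ' q n, ← mul_assoc, ← mul_assoc]
      refine Nat.mul_le_mul_right _ ?_
      obtain ⟨a, rfl⟩ := Nat.exists_eq_add_of_le hkd
      obtain ⟨b, hb⟩ := Nat.exists_eq_add_of_le (show k + a ≤ q by omega)
      rw [show q - (k + a) = b by omega, show q - k = a + b by omega,
        show q - (k + a - k) = k + b by omega, hb]
      -- With a = d - k and b = q - d the claim is b(k + a + b) ≤ (a + b)(k + b); the sides differ
      -- by ka.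
      nlinarith [Nat.zero_le (k * a)]
    · by_cases hdk : d - k ≤ q - 1
      · rw [affDist, if_pos (by omega), affDist, if_pos hdk, ← mul_assoc]
        refine Nat.mul_le_mul_right _ ?_
        obtain ⟨a, ha⟩ := Nat.exists_eq_add_of_le (show 1 ≤ q - k by omega)
        obtain ⟨b, hb⟩ := Nat.exists_eq_add_of_le (show 1 ≤ q - (d - k) by omega)
        rw [ha, hb, show q - (d - (q - 1)) = 1 + a + b by omega]
        nlinarith [Nat.zero_le (a * b)]
      · refine (ih (d - (q - 1)) k (by omega) hkq).trans_eq ?_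
        rw [affDist, if_neg hdk]
        congr 2
        omega

/-- The value b = q - 1 is allowed, since it is needed for b = μ + 1. The two ways of writing a
multiple of q - 1 then give the same value. -/
theorem affDist_eq {q : ℕ} (hq : 1 < q) (ν b n : ℕ) (hb : b ≤ q - 1) :
    affDist q (ν + 1 + n) (ν * (q - 1) + b) = (q - b) * q ^ n := by
  induction ν generalizing n with
  | zero => rw [show 0 + 1 + n = n + 1 by omega, affDist, if_pos (by omega)]; simp
  | succ ν ih =>
    rw [show ν + 1 + 1 + n = (ν + 1 + n) + 1 by omega, affDist]
    have hmul : (ν + 1) * (q - 1) = ν * (q - 1) + (q - 1) := Nat.succ_mul _ _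
    split_ifs with h
    · obtain rfl : b = 0 := by omega
      have hν : ν * (q - 1) = 0 := by omega
      obtain rfl : ν = 0 := by
        rcases Nat.mul_eq_zero.1 hν with h | h
        · exact h
        · omega
      rw [show q - ((0 + 1) * (q - 1) + 0) = 1 by simp; omega, show 0 + 1 + n = n + 1 by omega,
        pow_succ', Nat.sub_zero, one_mul]
    · rw [show (ν + 1) * (q - 1) + b - (q - 1) = ν * (q - 1) + b by omega, ih]

/-! ### Splitting words into affine part and part at infinity -/

section Words

variable {K : Type*} [Field K]

theorem hammingNorm_eq_sum [DecidableEq K] {ι : Type*} [Fintype ι] (x : ι → K) :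
    hammingNorm x = ∑ i, if x i ≠ 0 then 1 else 0 :=
  Finset.card_filter _ _

theorem hammingNorm_eq_sum_cons [Fintype K] [DecidableEq K] {n : ℕ} (x : AffWord K (n + 1)) :
    hammingNorm x = ∑ y : Fin n → K, hammingNorm fun s : K => x (Fin.cons s y) := by
  simp only [hammingNorm_eq_sum]
  rw [← Equiv.sum_comp (Fin.consEquiv fun _ : Fin (n + 1) => K), Fintype.sum_prod_type_right]
  rfl

variable {m : ℕ}

theorem projWord_ext {c c' : ProjWord K (m + 1)} (h₁ : affPart c = affPart c')
    (h₂ : infPart c = infPart c') : c = c' := by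
  funext ⟨Q, hQ⟩
  by_cases h : Q 0 = 1
  · have := congrFun h₁ (Fin.tail Q)
    have hc : Fin.cons 1 (Fin.tail Q) = Q := by rw [← h, Fin.cons_self_tail]
    simpa only [affPart, hc] using this
  · have h0 : Q 0 = 0 := by
      obtain ⟨i, hi, hj⟩ := hQ
      exact hj 0 (Fin.pos_of_ne_zero fun h' => h (h' ▸ hi))
    have := congrFun h₂ ⟨Fin.tail Q, isStd_tail hQ h⟩
    have hc : Fin.cons 0 (Fin.tail Q) = Q := by rw [← h0, Fin.cons_self_tail]
    simpa only [infPart, hc] using this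

variable [DecidableEq K]

theorem affPart_glue (c₁ : AffWord K (m + 1)) (c₂ : ProjWord K m) :
    affPart (glue c₁ c₂) = c₁ := by
  funext Q
  simp [affPart, glue]

theorem infPart_glue (c₁ : AffWord K (m + 1)) (c₂ : ProjWord K m) :
    infPart (glue c₁ c₂) = c₂ := by
  funext Q
  simp [infPart, glue]

theorem glue_eq_iff {c₁ : AffWord K (m + 1)} {c₂ : ProjWord K m} {c : ProjWord K (m + 1)} :
    glue c₁ c₂ = c ↔ c₁ = affPart c ∧ c₂ = infPart c := by
  constructor
  · rintro rfl
    exact ⟨(affPart_glue _ _).symm, (infPart_glue _ _).symm⟩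
  · rintro ⟨rfl, rfl⟩
    exact projWord_ext (affPart_glue _ _) (infPart_glue _ _)

/-- The decomposition `P^(m+1) = ({1} × K^(m+1)) ∪ ({0} × P^m)`. -/
def projPtEquiv (K : Type*) [Field K] [DecidableEq K] (m : ℕ) :
    (Fin (m + 1) → K) ⊕ ProjPt K m ≃ ProjPt K (m + 1) where
  toFun := Sum.elim (fun Q => ⟨Fin.cons 1 Q, isStd_cons_one Q⟩)
    (fun Q => ⟨Fin.cons 0 Q.1, isStd_cons_zero Q.2⟩)
  invFun Q := if h : Q.1 0 = 1 then .inl (Fin.tail Q.1) else .inr ⟨Fin.tail Q.1, isStd_tail Q.2 h⟩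
  left_inv Q := by
    rcases Q with Q | Q <;> simp
  right_inv Q := by
    obtain ⟨Q, hQ⟩ := Q
    by_cases h : Q 0 = 1
    · simp only [h, dite_true, Sum.elim_inl, Subtype.mk.injEq]
      rw [← h, Fin.cons_self_tail]
    · have h0 : Q 0 = 0 := by
        obtain ⟨i, hi, hj⟩ := hQ
        exact hj 0 (Fin.pos_of_ne_zero fun h' => h (h' ▸ hi))
      simp only [h, dite_false, Sum.elim_inr, Subtype.mk.injEq]
      rw [← h0, Fin.cons_self_tail]

theorem hammingNorm_eq_add [Fintype K] (r : ProjWord K (m + 1)) :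
    hammingNorm r = hammingNorm (affPart r) + hammingNorm (infPart r) := by
  simp only [hammingNorm_eq_sum]
  rw [← Equiv.sum_comp (projPtEquiv K m), Fintype.sum_sum_type]
  rfl

end Words

/-! ### Evaluation on the two parts, and the twist -/

section Evaluation

variable {K : Type*} [Field K] {m d : ℕ}

theorem affPart_evP_homog (f : MvPolynomial (Fin (m + 1)) K) :
    affPart (evP (homog d f)) = evA f :=
  funext fun Q => eval_homog_cons_one f Q

theorem infPart_evP_homog {f : MvPolynomial (Fin (m + 1)) K} (hf : f.totalDegree ≤ d) :
    infPart (evP (homog d f)) = evP (homogeneousComponent d f) :=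
  funext fun Q => eval_homog_cons_zero hf Q.1

theorem affPart_evP_rename (g : MvPolynomial (Fin (m + 1)) K) :
    affPart (evP (rename Fin.succ g)) = evA g := by
  funext Q
  simp [affPart, evP, evA, eval_rename, Function.comp_def]

theorem infPart_evP_rename (g : MvPolynomial (Fin (m + 1)) K) :
    infPart (evP (rename Fin.succ g)) = evP g := by
  funext Q
  simp [infPart, evP, eval_rename, Function.comp_def]

theorem evP_zero : evP (0 : MvPolynomial (Fin (m + 1)) K) = 0 :=
  funext fun _ => map_zero _

theorem evP_add (f g : MvPolynomial (Fin (m + 1)) K) : evP (f + g) = evP f + evP g :=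
  funext fun _ => map_add _ _ _

theorem evP_sub (f g : MvPolynomial (Fin (m + 1)) K) : evP (f - g) = evP f - evP g :=
  funext fun _ => map_sub _ _ _

theorem evA_sub {n : ℕ} (f g : MvPolynomial (Fin n) K) : evA (f - g) = evA f - evA g :=
  funext fun _ => map_sub _ _ _

theorem evP_eq_of_evA_eq {f g : MvPolynomial (Fin (m + 1)) K} (h : evA f = evA g) :
    evP f = evP g :=
  funext fun Q => congrFun h Q.1

theorem affPart_add (a b : ProjWord K (m + 1)) : affPart (a + b) = affPart a + affPart b := rfl

theorem infPart_add (a b : ProjWord K (m + 1)) : infPart (a + b) = infPart a + infPart b := rfl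

theorem sub_mem_PRM {c c' : ProjWord K m} (hc : c ∈ PRM K d m) (hc' : c' ∈ PRM K d m) :
    c - c' ∈ PRM K d m := by
  obtain ⟨f, hf, rfl⟩ := hc
  obtain ⟨g, hg, rfl⟩ := hc'
  exact ⟨f - g, IsHomogeneous.sub hf hg, evP_sub f g⟩

theorem exists_of_mem_PRM_succ {c : ProjWord K (m + 1)} (hc : c ∈ PRM K d (m + 1)) :
    ∃ f : MvPolynomial (Fin (m + 1)) K, f.totalDegree ≤ d ∧ affPart c = evA f ∧
      infPart c = evP (homogeneousComponent d f) := by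
  obtain ⟨F, hF, rfl⟩ := hc
  obtain ⟨f, hf, h₁, h₂⟩ := exists_dehomogenization hF
  exact ⟨f, hf, funext h₁, funext fun Q => h₂ Q.1⟩

theorem infPart_mem_PRM {c : ProjWord K (m + 1)} (hc : c ∈ PRM K d (m + 1)) :
    infPart c ∈ PRM K d m := by
  obtain ⟨f, -, -, h⟩ := exists_of_mem_PRM_succ hc
  exact h ▸ ⟨_, homogeneousComponent_isHomogeneous d f, rfl⟩

theorem isStd_ne_zero {n : ℕ} {Q : Fin n → K} (h : IsStd Q) : Q ≠ 0 := by
  rintro rfl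
  obtain ⟨i, hi, -⟩ := h
  exact zero_ne_one hi

theorem eq_of_smul_isStd {n : ℕ} {P P' : Fin n → K} (h : IsStd P) (h' : IsStd P') {a a' : K}
    (ha : a ≠ 0) (ha' : a' ≠ 0) (heq : a • P = a' • P') : a = a' ∧ P = P' := by
  obtain ⟨i, hi, hj⟩ := h
  obtain ⟨i', hi', hj'⟩ := h'
  have hii : i = i' := by
    rcases lt_trichotomy i i' with hlt | rfl | hlt
    · have := congrFun heq i
      simp [hi, hj' i hlt, ha] at this
    · rfl
    · have := congrFun heq i'
      simp [hi', hj i' hlt, ha'.symm] at this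
  subst hii
  have haa : a = a' := by
    have := congrFun heq i
    simpa [hi, hi'] using this
  subst haa
  exact ⟨rfl, smul_right_injective _ ha heq⟩

theorem exists_smul_isStd {n : ℕ} {Q : Fin n → K} (hQ : Q ≠ 0) :
    ∃ a : K, a ≠ 0 ∧ ∃ P, IsStd P ∧ a • P = Q := by
  classical
  obtain ⟨i₀, hi₀⟩ := Function.ne_iff.1 hQ
  have hne : (Finset.univ.filter fun i => Q i ≠ 0).Nonempty := ⟨i₀, by simpa using hi₀⟩
  have hi := (Finset.mem_filter.1 (Finset.min'_mem _ hne)).2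
  refine ⟨_, hi, (Q (Finset.min' _ hne))⁻¹ • Q, ⟨Finset.min' _ hne, ?_, fun j hj => ?_⟩,
    smul_inv_smul₀ hi Q⟩
  · rw [Pi.smul_apply, smul_eq_mul, inv_mul_cancel₀ hi]
  · have : Q j = 0 := by
      by_contra h
      exact absurd (Finset.min'_le _ j (by simpa using h)) (not_le.2 hj)
    rw [Pi.smul_apply, this, smul_zero]

variable [Fintype K] [DecidableEq K]

/-- Every nonzero point is ξ^r P for exactly one r ≤ q - 2 and one standard P, and a form of degree
d scales by ξ^(rd) there. At the origin a form of positive degree vanishes. -/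
theorem twist_evP {ξ : K} (hξ : IsPrimitiveRoot ξ (Fintype.card K - 1)) (hd : d ≠ 0)
    {g : MvPolynomial (Fin (m + 1)) K} (hg : g.IsHomogeneous d) : twist ξ d (evP g) = evA g := by
  have hq : 1 < Fintype.card K := Fintype.one_lt_card
  have hξ0 : ξ ≠ 0 := hξ.ne_zero (by omega)
  funext Q
  rw [twist, evA]
  rcases eq_or_ne Q 0 with rfl | hQ
  · rw [eval_zero_of_isHomogeneous hg hd]
    refine Finset.sum_eq_zero fun r _ => Finset.sum_eq_zero fun P _ => if_neg fun h => ?_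
    exact isStd_ne_zero P.2 ((smul_eq_zero_iff_right (pow_ne_zero r hξ0)).1 h)
  · obtain ⟨a, ha, P, hP, rfl⟩ := exists_smul_isStd hQ
    have : NeZero (Fintype.card K - 1) := ⟨by omega⟩
    obtain ⟨s, hs, rfl⟩ := hξ.eq_pow_of_pow_eq_one (FiniteField.pow_card_sub_one_eq_one a ha)
    rw [Finset.sum_eq_single_of_mem s (Finset.mem_range.2 hs), Finset.sum_eq_single ⟨P, hP⟩]
    · rw [if_pos rfl, eval_smul_of_isHomogeneous hg, pow_mul]
      rfl
    · intro P' _ hne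
      exact if_neg fun h => hne (Subtype.ext (eq_of_smul_isStd P'.2 hP ha ha h).2)
    · simp
    · intro r hr hne
      refine Finset.sum_eq_zero fun P' _ => if_neg fun h => hne ?_
      exact hξ.pow_inj (Finset.mem_range.1 hr) hs
        (eq_of_smul_isStd P'.2 hP (pow_ne_zero r hξ0) ha h).1

end Evaluation

/-! ### Minimum distance of affine Reed-Muller codes -/

section MinimumDistance

variable {K : Type*} [Field K] {d : ℕ}

theorem one_mem_RM (n : ℕ) : (1 : AffWord K n) ∈ RM K d n :=
  ⟨1, by simp, funext fun _ => map_one _⟩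

variable [DecidableEq K]

theorem minDist_le_hammingNorm {ι : Type*} [Fintype ι] {C : Set (ι → K)} {c : ι → K}
    (hc : c ∈ C) (h0 : c ≠ 0) : minDist C ≤ hammingNorm c :=
  Nat.sInf_le ⟨c, hc, h0, rfl⟩

/-- A nonzero codeword is required because the infimum of the empty set is 0. -/
theorem le_minDist {ι : Type*} [Fintype ι] {C : Set (ι → K)} {w : ℕ}
    (hne : ∃ c ∈ C, c ≠ 0) (hw : ∀ c ∈ C, c ≠ 0 → w ≤ hammingNorm c) : w ≤ minDist C := by
  obtain ⟨c, hc, h0⟩ := hne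
  refine le_csInf ⟨_, c, hc, h0, rfl⟩ ?_
  rintro _ ⟨c', hc', h0', rfl⟩
  exact hw c' hc' h0'

variable [Fintype K]

theorem card_sub_natDegree_le (p : Polynomial K) (hp : p ≠ 0) :
    Fintype.card K - p.natDegree ≤ hammingNorm fun s => p.eval s := by
  have h1 : (Finset.univ.filter fun s => p.eval s = 0).card ≤ p.natDegree := by
    refine le_trans (Finset.card_le_card fun s hs => ?_)
      ((Multiset.toFinset_card_le p.roots).trans (Polynomial.card_roots' p))
    rw [Multiset.mem_toFinset, Polynomial.mem_roots hp]
    exact (Finset.mem_filter.1 hs).2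
  have h2 := Finset.card_filter_add_card_filter_not (s := (Finset.univ : Finset K))
    fun s => p.eval s = 0
  rw [Finset.card_univ] at h2
  have h3 : hammingNorm (fun s => p.eval s) =
      (Finset.univ.filter fun s => ¬ p.eval s = 0).card := rfl
  omega

/-- View f as a polynomial of degree k in the first variable. Above each y where its leading
coefficient is nonzero, at least q - k points give nonzero values; the number of such y is bounded
by induction. -/
theorem affDist_le_hammingNorm_of_mem_restrictDegree {n : ℕ} {f : MvPolynomial (Fin n) K}
    (hf : f ∈ restrictDegree (Fin n) K (Fintype.card K - 1)) (h0 : f ≠ 0)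
    (hd : f.totalDegree ≤ d) : affDist (Fintype.card K) n d ≤ hammingNorm (evA f) := by
  induction n generalizing d with
  | zero =>
    rw [affDist, Nat.one_le_iff_ne_zero, Ne, hammingNorm_eq_zero]
    exact fun h => h0 (eq_zero_of_evA_eq_zero hf h)
  | succ n ih =>
    set p := finSuccEquiv K n f with hp
    have hp0 : p ≠ 0 := (map_ne_zero_iff _ (finSuccEquiv K n).injective).2 h0
    have hlc : p.leadingCoeff ≠ 0 := Polynomial.leadingCoeff_ne_zero.2 hp0
    have hdegOf : ∀ i, degreeOf i f ≤ Fintype.card K - 1 := fun i =>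
      degreeOf_le_iff.2 fun s hs => (mem_restrictDegree _ _ _).1 hf s hs i
    have hk : p.natDegree ≤ Fintype.card K - 1 :=
      (natDegree_finSuccEquiv f).trans_le (hdegOf 0)
    have hlcr : p.leadingCoeff ∈ restrictDegree (Fin n) K (Fintype.card K - 1) := by
      rw [mem_restrictDegree]
      exact fun s hs i => degreeOf_le_iff.1
        ((degreeOf_coeff_finSuccEquiv f i _).trans (hdegOf i.succ)) s hs
    have hdeg : p.leadingCoeff.totalDegree + p.natDegree ≤ d :=
      (totalDegree_coeff_finSuccEquiv_add_le f _ hlc).trans hd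
    refine (affDist_succ_le Fintype.one_lt_card n d p.natDegree (by omega) hk).trans ?_
    refine (Nat.mul_le_mul_left _ (ih hlcr hlc (by omega))).trans ?_
    rw [hammingNorm_eq_sum_cons, hammingNorm_eq_sum, Finset.mul_sum]
    refine Finset.sum_le_sum fun y _ => ?_
    split_ifs with hy
    · change eval y p.leadingCoeff ≠ 0 at hy
      have hnat : (p.map (eval y)).natDegree = p.natDegree :=
        Polynomial.natDegree_map_of_leadingCoeff_ne_zero _ hy
      have hne : p.map (eval y) ≠ 0 := fun h => hy (by
        have := congrArg (fun r => Polynomial.coeff r p.natDegree) h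
        simpa [Polynomial.coeff_map] using this)
      have := card_sub_natDegree_le _ hne
      rw [hnat] at this
      simpa only [mul_one, evA, eval_eq_eval_mv_eval', ← hp] using this
    · simp

theorem affDist_le_hammingNorm {n : ℕ} {c : AffWord K n} (hc : c ∈ RM K d n) (h0 : c ≠ 0) :
    affDist (Fintype.card K) n d ≤ hammingNorm c := by
  obtain ⟨f, hf, rfl⟩ := hc
  rw [← evA_reduce]
  refine affDist_le_hammingNorm_of_mem_restrictDegree (reduce_mem_restrictDegree f) ?_
    ((totalDegree_reduce_le f).trans hf)
  intro h
  rw [← evA_reduce, h] at h0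
  exact h0 (funext fun _ => map_zero _)

theorem exists_hammingNorm_eq_affDist (n d : ℕ) :
    ∃ c ∈ RM K d n, hammingNorm c = affDist (Fintype.card K) n d := by
  have hq : 1 < Fintype.card K := Fintype.one_lt_card
  induction n generalizing d with
  | zero => exact ⟨1, one_mem_RM 0, by simp [hammingNorm_eq_sum, affDist]⟩
  | succ n ih =>
    rw [affDist]
    split_ifs with hd
    · obtain ⟨S, -, hS⟩ := Finset.exists_subset_card_eq
        (show d ≤ (Finset.univ : Finset K).card by rw [Finset.card_univ]; omega)
      -- A product of d parallel hyperplanes.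
      refine ⟨_, ⟨∏ s ∈ S, (X 0 - C s), ?_, rfl⟩, ?_⟩
      · refine (totalDegree_finsetProd _ _).trans ?_
        refine (Finset.sum_le_card_nsmul _ _ 1 fun s _ => ?_).trans (by simp [hS])
        exact (totalDegree_sub_C_le _ _).trans (totalDegree_X _).le
      · rw [hammingNorm_eq_sum_cons]
        have : ∀ y : Fin n → K, (hammingNorm fun s : K =>
            evA (∏ s ∈ S, (X 0 - C s) : MvPolynomial (Fin (n + 1)) K) (Fin.cons s y)) =
            Fintype.card K - d := fun y => by
          rw [← hS, ← Finset.card_compl, hammingNorm]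
          congr 1
          ext s
          simp [evA, map_prod, Finset.prod_eq_zero_iff, sub_eq_zero]
        rw [Finset.sum_congr rfl fun y _ => this y]
        simp [mul_comm]
    · obtain ⟨_, ⟨f, hf, rfl⟩, hc⟩ := ih (d - (Fintype.card K - 1))
      -- The factor 1 - x₀^(q-1) is the indicator of x₀ = 0, where an extremal word in one variable
      -- fewer is placed.
      refine ⟨_, ⟨(1 - X 0 ^ (Fintype.card K - 1)) * rename Fin.succ f, ?_, rfl⟩, ?_⟩
      · have h1 : (1 - X 0 ^ (Fintype.card K - 1) :
            MvPolynomial (Fin (n + 1)) K).totalDegree ≤ Fintype.card K - 1 := by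
          refine (totalDegree_sub _ _).trans ?_
          rw [totalDegree_X_pow, totalDegree_one]
          omega
        have h2 := (totalDegree_rename_le Fin.succ f).trans hf
        refine (totalDegree_mul _ _).trans ?_
        omega
      · rw [hammingNorm_eq_sum_cons, ← hc, hammingNorm_eq_sum]
        refine Finset.sum_congr rfl fun y _ => ?_
        rw [hammingNorm_eq_sum, Finset.sum_eq_single 0]
        · have hcons : eval (Fin.cons 0 y : Fin (n + 1) → K) (rename Fin.succ f) = eval y f := by
            rw [eval_rename]
            rfl
          by_cases hy : eval y f = 0 <;>
            simp [evA, hcons, hy, zero_pow (show Fintype.card K - 1 ≠ 0 by omega)]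
        · intro s _ hs
          simp [evA, FiniteField.pow_card_sub_one_eq_one s hs]
        · simp

theorem minDist_RM (d n : ℕ) : minDist (RM K d n) = affDist (Fintype.card K) n d := by
  have hq : 1 < Fintype.card K := Fintype.one_lt_card
  refine le_antisymm ?_ (le_minDist ⟨1, one_mem_RM n, one_ne_zero⟩
    fun c hc h0 => affDist_le_hammingNorm hc h0)
  obtain ⟨c, hc, hw⟩ := exists_hammingNorm_eq_affDist (K := K) n d
  rw [← hw]
  refine minDist_le_hammingNorm hc fun h => ?_
  have := affDist_pos hq n d
  rw [← hw, h, hammingNorm_zero] at this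
  exact this.false

/-- There is a codeword of weight one when the degree exceeds `m (q - 1)`. -/
theorem minDist_PRM_le_one {m : ℕ} (hd : m * (Fintype.card K - 1) < d) :
    minDist (PRM K d m) ≤ 1 := by
  have hq : 1 < Fintype.card K := Fintype.one_lt_card
  -- This form is supported at (1 : 0 : ⋯ : 0) only.
  set F : MvPolynomial (Fin (m + 1)) K := X 0 ^ (d - m * (Fintype.card K - 1)) *
    ∏ i : Fin m, (X 0 ^ (Fintype.card K - 1) - X i.succ ^ (Fintype.card K - 1)) with hF
  have hhom : F.IsHomogeneous d := by
    have h := (isHomogeneous_X_pow (R := K) (0 : Fin (m + 1)) (d - m * (Fintype.card K - 1))).mul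
      (IsHomogeneous.prod Finset.univ
        (fun i : Fin m => (X 0 ^ (Fintype.card K - 1) - X i.succ ^ (Fintype.card K - 1) :
          MvPolynomial (Fin (m + 1)) K)) (fun _ => Fintype.card K - 1)
        fun i _ => (isHomogeneous_X_pow _ _).sub (isHomogeneous_X_pow _ _))
    convert h using 1
    simp
    omega
  let P₀ : ProjPt K m := ⟨Fin.cons 1 0, isStd_cons_one 0⟩
  have hval : evP F = Pi.single P₀ 1 := by
    funext ⟨Q, hQ⟩
    by_cases h0 : Q 0 = 0
    · have hne : (⟨Q, hQ⟩ : ProjPt K m) ≠ P₀ := fun h => by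
        have := congrFun (congrArg Subtype.val h) 0
        simp [P₀, h0] at this
      rw [Pi.single_eq_of_ne hne]
      simp [evP, hF, h0, show d - m * (Fintype.card K - 1) ≠ 0 by omega]
    · have h1 : Q 0 = 1 := by
        obtain ⟨i, hi, hj⟩ := hQ
        rcases Fin.eq_zero_or_eq_succ i with rfl | ⟨j, rfl⟩
        · exact hi
        · exact absurd (hj 0 (Fin.succ_pos j)) h0
      by_cases hP : (⟨Q, hQ⟩ : ProjPt K m) = P₀
      · rw [hP, Pi.single_eq_same]
        simp [evP, hF, P₀, show Fintype.card K - 1 ≠ 0 by omega]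
      · rw [Pi.single_eq_of_ne hP]
        have : ∃ i : Fin m, Q i.succ ≠ 0 := by
          by_contra! h
          refine hP (Subtype.ext (funext fun i => ?_))
          induction i using Fin.cases with
          | zero => simpa [P₀] using h1
          | succ i => simpa [P₀] using h i
        obtain ⟨i, hi⟩ := this
        rw [evP, hF, eval_mul, map_prod,
          Finset.prod_eq_zero (Finset.mem_univ i), mul_zero]
        simp [h1, FiniteField.pow_card_sub_one_eq_one _ hi]
  have hmem : evP F ∈ PRM K d m := ⟨F, hhom, rfl⟩
  refine (minDist_le_hammingNorm hmem ?_).trans ?_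
  · rw [hval]
    simp
  · rw [hval, hammingNorm]
    refine Finset.card_le_one.2 fun a ha b hb => ?_
    simp only [Finset.mem_filter, Finset.mem_univ, true_and, Pi.single_apply] at ha hb
    aesop

end MinimumDistance

/-! ### The bound η and the projective minimum distance -/

section ProjectiveDistance

variable {K : Type*} [Field K]

theorem exists_ne_zero_mem_PRM (d m : ℕ) : ∃ c ∈ PRM K d m, c ≠ 0 := by
  refine ⟨_, ⟨X 0 ^ d, isHomogeneous_X_pow 0 d, rfl⟩, fun h => ?_⟩
  have := congrFun h ⟨Fin.cons 1 0, isStd_cons_one 0⟩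
  simp [evP] at this

theorem evA_eq_zero_of_evP_eq_zero {d m : ℕ} (hd : d ≠ 0) {g : MvPolynomial (Fin (m + 1)) K}
    (hg : g.IsHomogeneous d) (h : evP g = 0) : evA g = 0 := by
  funext Q
  rcases eq_or_ne Q 0 with rfl | hQ
  · exact eval_zero_of_isHomogeneous hg hd
  · obtain ⟨a, -, P, hP, rfl⟩ := exists_smul_isStd hQ
    have h' : eval P g = 0 := congrFun h ⟨P, hP⟩
    rw [evA, eval_smul_of_isHomogeneous hg, h', mul_zero, Pi.zero_apply]

variable [Fintype K] [DecidableEq K]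

theorem eta_eq (ν d m : ℕ) :
    eta K ν d m = (∑ i ∈ Finset.range (m - ν), affDist (Fintype.card K) (m - i) d) + 1 := by
  simp only [eta, minDist_RM]

theorem eta_of_le {ν m : ℕ} (h : m ≤ ν) (d : ℕ) : eta K ν d m = 1 := by
  rw [eta, Nat.sub_eq_zero_of_le h, Finset.range_zero, Finset.sum_empty]

theorem eta_succ {ν m : ℕ} (h : ν ≤ m) (d : ℕ) :
    eta K ν d (m + 1) = minDist (RM K d (m + 1)) + eta K ν d m := by
  rw [eta_eq, eta_eq, minDist_RM, show m + 1 - ν = (m - ν) + 1 by omega, Finset.sum_range_succ']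
  simp only [Nat.add_sub_add_right, Nat.sub_zero]
  omega

/-- In every term of the sum the degree exceeds q - 1, so one variable and q - 1 degrees can be
removed together. -/
theorem eta_succ_succ {ν m d : ℕ} (hd : Fintype.card K ≤ d) :
    eta K (ν + 1) d (m + 1) = eta K ν (d - (Fintype.card K - 1)) m := by
  have hq : 1 < Fintype.card K := Fintype.one_lt_card
  rw [eta_eq, eta_eq, Nat.add_sub_add_right]
  congr 1
  refine Finset.sum_congr rfl fun i hi => ?_
  rw [Finset.mem_range] at hi
  rw [show m + 1 - i = (m - i) + 1 by omega, affDist, if_neg (by omega)]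

/-- With a = q - μ - 1 and n = m - ν - 1, this is 1 + a(1 + q + ⋯ + q^n) ≤ (a + 1)q^n, which holds
since a + 1 ≤ q. -/
theorem eta_le_minDist_RM {ν μ m d : ℕ} (hd : d = ν * (Fintype.card K - 1) + μ + 1)
    (hμ : μ < Fintype.card K - 1) (hm : ν < m) :
    eta K ν d m ≤ minDist (RM K (d - 1) m) := by
  have hq : 1 < Fintype.card K := Fintype.one_lt_card
  obtain ⟨n, rfl⟩ := Nat.exists_eq_add_of_le (Nat.succ_le_of_lt hm)
  rw [minDist_RM, show d - 1 = ν * (Fintype.card K - 1) + μ by omega, Nat.succ_eq_add_one,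
    affDist_eq hq _ _ _ hμ.le]
  obtain ⟨a, ha⟩ := Nat.exists_eq_add_of_le (show μ + 1 ≤ Fintype.card K by omega)
  have hdist : ∀ n, minDist (RM K d (ν + 1 + n)) = a * Fintype.card K ^ n := fun n => by
    rw [minDist_RM, show d = ν * (Fintype.card K - 1) + (μ + 1) by omega,
      affDist_eq hq _ _ _ (by omega)]
    congr 1
    omega
  rw [show Fintype.card K - μ = a + 1 by omega]
  clear hm
  induction n with
  | zero =>
    rw [add_zero, eta_succ le_rfl, eta_of_le le_rfl, ← add_zero (ν + 1), hdist]
    simp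
  | succ n ih =>
    rw [← add_assoc, eta_succ (by omega), add_assoc (ν + 1), hdist, add_mul, one_mul]
    refine Nat.add_le_add_left (ih.trans ?_) _
    rw [pow_succ']
    exact Nat.mul_le_mul_right _ (by omega)

theorem eta_le_hammingNorm {m : ℕ} : ∀ {ν μ d : ℕ}, d = ν * (Fintype.card K - 1) + μ + 1 →
    μ < Fintype.card K - 1 → ∀ {c : ProjWord K m}, c ∈ PRM K d m → c ≠ 0 →
    eta K ν d m ≤ hammingNorm c := by
  induction m with
  | zero =>
    intro ν μ d hd hμ c hc h0
    rw [eta_of_le (Nat.zero_le ν), Nat.one_le_iff_ne_zero]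
    exact hammingNorm_ne_zero_iff.2 h0
  | succ m ih =>
    intro ν μ d hd hμ c hc h0
    rcases Nat.lt_or_ge m ν with hν | hν
    · rw [eta_of_le hν, Nat.one_le_iff_ne_zero]
      exact hammingNorm_ne_zero_iff.2 h0
    obtain ⟨f, hf, h₁, h₂⟩ := exists_of_mem_PRM_succ hc
    rw [hammingNorm_eq_add]
    -- If the part at infinity is zero, the leading form vanishes on affine space too, and the
    -- affine part is a word of RM_{d-1}.
    by_cases hinf : infPart c = 0
    · have hz := evA_eq_zero_of_evP_eq_zero (by omega) (homogeneousComponent_isHomogeneous d f)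
        (h₂.symm.trans hinf)
      have haff : affPart c ≠ 0 := fun h => h0 (projWord_ext h hinf)
      have hmem : affPart c ∈ RM K (d - 1) (m + 1) := by
        refine ⟨f - homogeneousComponent d f, ?_, by rw [evA_sub, hz, sub_zero, h₁]⟩
        exact Nat.le_sub_one_of_lt (totalDegree_sub_homogeneousComponent_lt hf (by omega))
      exact ((eta_le_minDist_RM hd hμ (by omega)).trans
        (minDist_le_hammingNorm hmem haff)).trans (Nat.le_add_right _ _)
    -- If the affine part is zero, the part at infinity is a word of the code of degree d - (q - 1),
    -- which has the same bound η; for d < q it would be zero.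
    by_cases haff : affPart c = 0
    · refine le_trans ?_ (Nat.le_add_left _ _)
      rcases Nat.lt_or_ge d (Fintype.card K) with hdq | hdq
      · refine absurd ?_ hinf
        have : f = 0 := eq_zero_of_evA_eq_zero
          (mem_restrictDegree_of_totalDegree_le (by omega)) (h₁.symm.trans haff)
        rw [h₂, this, map_zero, evP_zero]
      · obtain ⟨g, hg, hgf⟩ := exists_lower_form_of_evA_eq_zero hf (h₁.symm.trans haff) hdq
        obtain ⟨ν, rfl⟩ : ∃ ν', ν = ν' + 1 :=
          Nat.exists_eq_succ_of_ne_zero (by rintro rfl; omega)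
        rw [eta_succ_succ hdq]
        refine ih (μ := μ) ?_ hμ ⟨g, hg, ?_⟩ hinf
        · rw [Nat.succ_mul] at hd
          omega
        · rw [h₂, evP_eq_of_evA_eq hgf]
    · rw [eta_succ hν]
      exact Nat.add_le_add (minDist_le_hammingNorm ⟨f, hf, h₁.symm⟩ haff)
        (ih hd hμ (infPart_mem_PRM hc) hinf)

theorem eta_le_minDist_PRM {ν μ d m : ℕ} (hd : d = ν * (Fintype.card K - 1) + μ + 1)
    (hμ : μ < Fintype.card K - 1) : eta K ν d m ≤ minDist (PRM K d m) :=
  le_minDist (exists_ne_zero_mem_PRM d m) fun _ hc h0 => eta_le_hammingNorm hd hμ hc h0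

end ProjectiveDistance

/-! ### Correctness of the decoder -/

section Decoding

variable {K : Type*} [Field K]

theorem solve_sound {m d : ℕ} {r c : ProjWord K m} {f : MvPolynomial (Fin (m + 1)) K}
    (h : solve d r = some (c, f)) : f.IsHomogeneous d ∧ evP f = c := by
  rw [solve] at h
  split_ifs at h with hex
  simp only [Option.some.injEq, Prod.mk.injEq] at h
  obtain ⟨rfl, rfl⟩ := h
  exact hex.choose_spec

theorem exists_solve_eq_some {m d : ℕ} {c : ProjWord K m} (hc : c ∈ PRM K d m) :
    ∃ f, solve d c = some (c, f) :=
  ⟨_, dif_pos hc⟩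

variable [Fintype K] [DecidableEq K]

theorem eq_of_hammingNorm_lt {m d : ℕ} {c c' e : ProjWord K m} (hc : c ∈ PRM K d m)
    (hc' : c' ∈ PRM K d m) (he : 2 * hammingNorm e < minDist (PRM K d m))
    (he' : 2 * hammingNorm (c + e - c') < minDist (PRM K d m)) : c' = c := by
  by_contra hne
  have h := minDist_le_hammingNorm (sub_mem_PRM hc' hc) (sub_ne_zero.2 hne)
  have htri : hammingNorm (c' - c) ≤ hammingNorm e + hammingNorm (c + e - c') := by
    rw [show c' - c = -(c + e - c') + e by abel, ← hammingDist_eq_hammingNorm]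
    refine (hammingDist_triangle (c + e - c') 0 e).trans_eq ?_
    rw [hammingDist_zero_right, hammingDist_zero_left, add_comm]
  omega

theorem natCast_lt_half_iff {a b : ℕ} : (a : ℚ) < (b : ℚ) / 2 ↔ 2 * a < b := by
  rw [lt_div_iff₀ two_pos, mul_comm]
  exact_mod_cast Iff.rfl

variable {ξ : K} {DA : (d j : ℕ) → AffWord K j → Option (AffWord K j × MvPolynomial (Fin j) K)}
  {m d : ℕ} {DP : ℕ → ProjWord K m → ProjAnswer K m}

/-- The reduced polynomial has degree below d, so its homogenization vanishes at infinity, where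
f_bad and f_good remain. On the affine part these two cancel what was subtracted from f⁰. -/
theorem evP_recombination (hd : Fintype.card K ≤ d) {f₀ fbad : MvPolynomial (Fin (m + 1)) K}
    (hf₀ : f₀.totalDegree ≤ d) (hbad : fbad.IsHomogeneous (d - (Fintype.card K - 1))) :
    (homog d (reduce (f₀ - fbad - homogeneousComponent d f₀)) +
      rename Fin.succ (raise d fbad) +
      rename Fin.succ (homogeneousComponent d f₀)).IsHomogeneous d ∧
    evP (homog d (reduce (f₀ - fbad - homogeneousComponent d f₀)) +
      rename Fin.succ (raise d fbad) + rename Fin.succ (homogeneousComponent d f₀)) =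
      glue (evA f₀) (evP (homogeneousComponent d f₀) + evP fbad) := by
  have hq : 1 < Fintype.card K := Fintype.one_lt_card
  have hg : (reduce (f₀ - fbad - homogeneousComponent d f₀)).totalDegree < d := by
    refine (totalDegree_reduce_le _).trans_lt ?_
    rw [sub_right_comm]
    refine (totalDegree_sub _ _).trans_lt (max_lt ?_ ?_)
    · exact totalDegree_sub_homogeneousComponent_lt hf₀ (by omega)
    · exact hbad.totalDegree_le.trans_lt (by omega)
  have hraise : evA (raise d fbad) = evA fbad := funext fun Q => eval_raise hbad (by omega) Q
  refine ⟨((isHomogeneous_homog hg.le).add ?_).add ?_, ?_⟩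
  · exact (isHomogeneous_raise hbad (by omega) (by omega)).rename_isHomogeneous
  · exact (homogeneousComponent_isHomogeneous d f₀).rename_isHomogeneous
  · rw [evP_add, evP_add, eq_comm, glue_eq_iff, affPart_add, affPart_add, infPart_add,
      infPart_add, affPart_evP_homog, infPart_evP_homog hg.le, affPart_evP_rename,
      affPart_evP_rename, infPart_evP_rename, infPart_evP_rename,
      homogeneousComponent_eq_zero _ _ hg, evP_eq_of_evA_eq hraise, hraise, evA_reduce,
      evA_sub, evA_sub]
    refine ⟨by abel, ?_⟩
    rw [evP_zero, zero_add, add_comm]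

/-- The distance bound matters when the affine decoder is misled: whatever is returned is still the
only codeword that close to r. -/
theorem firstPart_sound (hDA : IsRMDecoder d (m + 1) (DA d (m + 1)))
    (hDP : Fintype.card K ≤ d → ∀ r c f, DP (d - (Fintype.card K - 1)) r = some (c, f) →
      f.IsHomogeneous (d - (Fintype.card K - 1)) ∧ evP f = c)
    {r c : ProjWord K (m + 1)} {f : MvPolynomial (Fin (m + 2)) K}
    (h : firstPart DA DP d r = some (c, f)) :
    (f.IsHomogeneous d ∧ evP f = c) ∧
      2 * hammingNorm (r - c) < minDist (PRM K d (m + 1)) := by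
  rw [firstPart] at h
  rcases hA : DA d (m + 1) (affPart r) with _ | ⟨c₁, f₀⟩
  · simp [hA] at h
  obtain ⟨hf₀, rfl⟩ := hDA.1 _ _ _ hA
  simp only [hA, natCast_lt_half_iff] at h
  split_ifs at h with hd ht
  · simp only [Option.some.injEq, Prod.mk.injEq] at h
    obtain ⟨rfl, rfl⟩ := h
    exact ⟨⟨isHomogeneous_homog hf₀, rfl⟩, ht⟩
  · rw [homogeneousComponent_goodPart] at h
    rcases hP : DP (d - (Fintype.card K - 1))
      (infPart r - evP (homogeneousComponent d f₀)) with _ | ⟨cbad, fbad⟩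
    · simp [hP] at h
    obtain ⟨hbad, rfl⟩ := hDP (by omega) _ _ _ hP
    simp only [hP] at h
    split_ifs at h with ht
    simp only [Option.some.injEq, Prod.mk.injEq] at h
    obtain ⟨rfl, rfl⟩ := h
    exact ⟨evP_recombination (by omega) hf₀ hbad, ht⟩

theorem exists_firstPart_eq_some (hDA : IsRMDecoder d (m + 1) (DA d (m + 1)))
    {c e : ProjWord K (m + 1)} (hc : c ∈ PRM K d (m + 1))
    (hDP : Fintype.card K ≤ d → ∀ c' ∈ PRM K (d - (Fintype.card K - 1)) m,
      ∃ f, DP (d - (Fintype.card K - 1)) (c' + infPart e) = some (c', f))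
    (he₁ : 2 * hammingNorm (affPart e) < minDist (RM K d (m + 1)))
    (he : 2 * hammingNorm e < minDist (PRM K d (m + 1))) :
    ∃ f, firstPart DA DP d (c + e) = some (c, f) := by
  obtain ⟨f, hf, h₁, h₂⟩ := exists_of_mem_PRM_succ hc
  obtain ⟨f₀, hA⟩ := hDA.2 (affPart c) ⟨f, hf, h₁.symm⟩ (affPart e) (natCast_lt_half_iff.2 he₁)
  obtain ⟨hf₀, hev⟩ := hDA.1 _ _ _ hA
  have hzero : evA (f - f₀) = 0 := by rw [evA_sub, hev, h₁, sub_self]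
  have hdeg : (f - f₀).totalDegree ≤ d := (totalDegree_sub _ _).trans (max_le hf hf₀)
  rw [← affPart_add] at hA
  by_cases hd : d ≤ Fintype.card K - 1
  · have hc' : evP (homog d f₀) = c := by
      refine projWord_ext (by rw [affPart_evP_homog, hev]) ?_
      rw [infPart_evP_homog hf₀, h₂, sub_eq_zero.1 (eq_zero_of_evA_eq_zero
        (mem_restrictDegree_of_totalDegree_le (hdeg.trans hd)) hzero)]
    simp only [firstPart, hA, natCast_lt_half_iff, if_pos hd, hc', add_sub_cancel_left, if_pos he]
    exact ⟨_, rfl⟩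
  -- The form g measures how far the leading form of f⁰ is from that of f; its values are the word
  -- that the recursive call has to find.
  · obtain ⟨g, hg, hgf⟩ := exists_lower_form_of_evA_eq_zero hdeg hzero (by omega)
    have hinf : infPart c = evP (homogeneousComponent d f₀) + evP g := by
      rw [evP_eq_of_evA_eq hgf, map_sub, evP_sub, h₂, add_sub_cancel]
    obtain ⟨fbad, hP⟩ := hDP (by omega) (evP g) ⟨g, hg, rfl⟩
    have harg : infPart (c + e) - evP (homogeneousComponent d f₀) = evP g + infPart e := by
      rw [infPart_add, hinf]
      abel
    have hglue : glue (affPart c) (evP (homogeneousComponent d f₀) + evP g) = c :=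
      glue_eq_iff.2 ⟨rfl, hinf.symm⟩
    simp only [firstPart, hA, natCast_lt_half_iff, if_neg hd, homogeneousComponent_goodPart,
      harg, hP, hglue, add_sub_cancel_left, if_pos he]
    exact ⟨_, rfl⟩

theorem secondPart_sound (hξ : IsPrimitiveRoot ξ (Fintype.card K - 1)) (hd : 1 ≤ d)
    (hDA : IsRMDecoder (d - 1) (m + 1) (DA (d - 1) (m + 1)))
    (hDP : ∀ r c f, DP d r = some (c, f) → f.IsHomogeneous d ∧ evP f = c)
    {r c : ProjWord K (m + 1)} {f : MvPolynomial (Fin (m + 2)) K}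
    (h : secondPart ξ DA DP d r = some (c, f)) : f.IsHomogeneous d ∧ evP f = c := by
  rw [secondPart] at h
  rcases hP : DP d (infPart r) with _ | ⟨v, g⟩
  · simp [hP] at h
  obtain ⟨hg, rfl⟩ := hDP _ _ _ hP
  simp only [hP] at h
  rcases hA : DA (d - 1) (m + 1) (affPart r - twist ξ d (evP g)) with _ | ⟨u, f₀⟩
  · simp [hA] at h
  obtain ⟨hf₀, rfl⟩ := hDA.1 _ _ _ hA
  simp only [hA, Option.some.injEq, Prod.mk.injEq] at h
  obtain ⟨rfl, rfl⟩ := h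
  have hle : f₀.totalDegree ≤ d := hf₀.trans (Nat.sub_le _ _)
  refine ⟨(isHomogeneous_homog hle).add hg.rename_isHomogeneous, ?_⟩
  rw [twist_evP hξ (by omega) hg, evP_add, eq_comm, glue_eq_iff, affPart_add, infPart_add,
    affPart_evP_homog, infPart_evP_homog hle, affPart_evP_rename, infPart_evP_rename,
    homogeneousComponent_eq_zero _ _ (by omega)]
  exact ⟨rfl, by rw [evP_zero, zero_add]⟩

theorem exists_secondPart_eq_some (hξ : IsPrimitiveRoot ξ (Fintype.card K - 1)) (hd : 1 ≤ d)
    (hDA : IsRMDecoder (d - 1) (m + 1) (DA (d - 1) (m + 1)))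
    {c e : ProjWord K (m + 1)} (hc : c ∈ PRM K d (m + 1))
    (hDP : ∃ f, DP d (infPart c + infPart e) = some (infPart c, f))
    (he : 2 * hammingNorm (affPart e) < minDist (RM K (d - 1) (m + 1))) :
    ∃ f, secondPart ξ DA DP d (c + e) = some (c, f) := by
  obtain ⟨f, hf, h₁, h₂⟩ := exists_of_mem_PRM_succ hc
  obtain ⟨g, hP⟩ := hDP
  have htwist : twist ξ d (infPart c) = evA (homogeneousComponent d f) := by
    rw [h₂, twist_evP hξ (by omega) (homogeneousComponent_isHomogeneous d f)]
  obtain ⟨f₀, hA⟩ := hDA.2 (affPart c - twist ξ d (infPart c))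
    ⟨f - homogeneousComponent d f,
      Nat.le_sub_one_of_lt (totalDegree_sub_homogeneousComponent_lt hf hd),
      by rw [evA_sub, h₁, htwist]⟩ (affPart e) (natCast_lt_half_iff.2 he)
  rw [sub_add_eq_add_sub, ← affPart_add] at hA
  rw [← infPart_add] at hP
  have hglue : glue (affPart c) (infPart c) = c := glue_eq_iff.2 ⟨rfl, rfl⟩
  simp only [secondPart, hP, hA, sub_add_cancel, hglue]
  exact ⟨_, rfl⟩

theorem decode_sound (hξ : IsPrimitiveRoot ξ (Fintype.card K - 1)) :
    ∀ {m d : ℕ}, 1 ≤ d →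
    (∀ j d', 1 ≤ j → j ≤ m → d' ≤ d → d' ≤ j * (Fintype.card K - 1) →
      IsRMDecoder d' j (DA d' j)) →
    ∀ r c f, decode ξ DA m d r = some (c, f) → f.IsHomogeneous d ∧ evP f = c := by
  have hq : 1 < Fintype.card K := Fintype.one_lt_card
  intro m
  induction m with
  | zero =>
    intro d hd _ r c f h
    simp only [decode, Option.some.injEq, Prod.mk.injEq] at h
    obtain ⟨rfl, rfl⟩ := h
    refine ⟨isHomogeneous_C_mul_X_pow _ _ _, funext fun ⟨Q, hQ⟩ => ?_⟩
    have hQ1 : Q = fun _ => 1 := by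
      obtain ⟨i, hi, -⟩ := hQ
      funext j
      rw [show j = i from Fin.ext (by omega), hi]
    subst hQ1
    simp [evP]
  | succ m ih =>
    intro d hd hDA r c f h
    have ih' : ∀ d', 1 ≤ d' → d' ≤ d → ∀ r c f, decode ξ DA m d' r = some (c, f) →
        f.IsHomogeneous d' ∧ evP f = c := fun d' h1 hle =>
      ih h1 fun j d'' hj hjm hd'' => hDA j d'' hj (by omega) (by omega)
    rw [decode] at h
    split_ifs at h with ht
    · exact solve_sound h
    have hdm : d ≤ (m + 1) * (Fintype.card K - 1) := by
      by_contra hlt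
      refine ht ?_
      have : ((minDist (PRM K d (m + 1)) : ℕ) : ℚ) ≤ 1 := by
        exact_mod_cast minDist_PRM_le_one (not_le.1 hlt)
      linarith
    rcases hfirst : firstPart DA (decode ξ DA m) d r with _ | ⟨c', f'⟩
    · simp only [hfirst] at h
      exact secondPart_sound hξ hd (hDA _ _ (by omega) le_rfl (by omega) (by omega))
        (ih' d hd le_rfl) h
    · simp only [hfirst, Option.some.injEq, Prod.mk.injEq] at h
      obtain ⟨rfl, rfl⟩ := h
      exact (firstPart_sound (hDA _ _ (by omega) le_rfl le_rfl hdm)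
        (fun hqd => ih' _ (by omega) (by omega)) hfirst).1

/-- No bound d ≤ m(q - 1) is imposed, because the recursion lowers m while possibly keeping d. -/
theorem exists_decode_eq_some (hξ : IsPrimitiveRoot ξ (Fintype.card K - 1)) :
    ∀ {m ν μ d : ℕ}, d = ν * (Fintype.card K - 1) + μ + 1 → μ < Fintype.card K - 1 →
    (∀ j d', 1 ≤ j → j ≤ m → d' ≤ d → d' ≤ j * (Fintype.card K - 1) →
      IsRMDecoder d' j (DA d' j)) →
    ∀ {c e : ProjWord K m}, c ∈ PRM K d m → 2 * hammingNorm e < eta K ν d m →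
    ∃ f, decode ξ DA m d (c + e) = some (c, f) := by
  have hq : 1 < Fintype.card K := Fintype.one_lt_card
  intro m
  induction m with
  | zero =>
    intro ν μ d _ _ _ c e _ he
    rw [eta_of_le (Nat.zero_le ν)] at he
    rw [hammingNorm_eq_zero.1 (show hammingNorm e = 0 by omega), add_zero]
    exact ⟨_, rfl⟩
  | succ m ih =>
    intro ν μ d hd hμ hDA c e hc he
    have hdist : eta K ν d (m + 1) ≤ minDist (PRM K d (m + 1)) := eta_le_minDist_PRM hd hμ
    rw [decode]
    split_ifs with ht
    -- Here 2 wt(e) < η ≤ 2, so there is no error at all.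
    · have : minDist (PRM K d (m + 1)) ≤ 2 := by
        have : ((minDist (PRM K d (m + 1)) : ℕ) : ℚ) ≤ 2 := by linarith
        exact_mod_cast this
      rw [hammingNorm_eq_zero.1 (show hammingNorm e = 0 by omega), add_zero]
      exact exists_solve_eq_some hc
    -- For larger d there is a word of weight one, and step 1 would have applied. So the affine
    -- decoder of degree d is available.
    have hdm : d ≤ (m + 1) * (Fintype.card K - 1) := by
      by_contra hlt
      refine ht ?_
      have : ((minDist (PRM K d (m + 1)) : ℕ) : ℚ) ≤ 1 := by
        exact_mod_cast minDist_PRM_le_one (not_le.1 hlt)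
      linarith
    have hν : ν ≤ m := by
      by_contra hlt
      have := Nat.mul_le_mul_right (Fintype.card K - 1) (show m + 1 ≤ ν by omega)
      omega
    have hdecA : IsRMDecoder d (m + 1) (DA d (m + 1)) := hDA _ _ (by omega) le_rfl le_rfl hdm
    have hsplit := hammingNorm_eq_add e
    have hsound : ∀ d', 1 ≤ d' → d' ≤ d → ∀ r c f, decode ξ DA m d' r = some (c, f) →
        f.IsHomogeneous d' ∧ evP f = c := fun d' h1 hle =>
      decode_sound hξ h1 fun j d'' hj hjm hd'' => hDA j d'' hj (by omega) (by omega)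
    rcases hfirst : firstPart DA (decode ξ DA m) d (c + e) with _ | ⟨c', f'⟩
    · refine exists_secondPart_eq_some hξ (by omega)
        (hDA _ _ (by omega) le_rfl (by omega) (by omega)) hc ?_ ?_
      · refine ih hd hμ (fun j d' hj hjm => hDA j d' hj (by omega)) (infPart_mem_PRM hc) ?_
        -- If e₂ is too heavy for the recursive call, then e₁ is light enough for the affine
        -- decoder, and step 2 would have returned.
        by_contra hinf
        have haff : 2 * hammingNorm (affPart e) < minDist (RM K d (m + 1)) := by
          rw [eta_succ hν] at he
          omega
        obtain ⟨f, hf⟩ := exists_firstPart_eq_some (DP := decode ξ DA m) hdecA hc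
          (fun hqd c' hc' => by
            -- For ν = 0 one has d = μ + 1 < q.
            obtain ⟨ν, rfl⟩ : ∃ ν', ν = ν' + 1 :=
              Nat.exists_eq_succ_of_ne_zero (by rintro rfl; omega)
            rw [eta_succ_succ hqd] at he
            refine ih (ν := ν) (μ := μ) ?_ hμ
              (fun j d' hj hjm hd' => hDA j d' hj (by omega) (by omega)) hc' (by omega)
            rw [Nat.succ_mul] at hd
            omega) haff (by omega)
        rw [hfirst] at hf
        cases hf
      · have := eta_le_minDist_RM hd hμ (show ν < m + 1 by omega)
        omega
    · obtain ⟨⟨hf', hev⟩, hlt⟩ := firstPart_sound hdecA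
        (fun hqd => hsound _ (by omega) (by omega)) hfirst
      exact ⟨f', by rw [eq_of_hammingNorm_lt hc ⟨f', hf', hev⟩ (by omega) hlt]⟩

end Decoding

end PRMDecoding
theorem theorem3p2 {K : Type*} [Field K] [Fintype K] [DecidableEq K]
    (ξ : K) (hξ : IsPrimitiveRoot ξ (Fintype.card K - 1))
    (m d ν μ : ℕ) (hm : 1 ≤ m)
    (hd : d = ν * (Fintype.card K - 1) + μ + 1) (hμ : μ < Fintype.card K - 1)
    (hdm : d ≤ m * (Fintype.card K - 1))
    (DA : (d j : ℕ) → PRMDecoding.AffWord K j →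
      Option (PRMDecoding.AffWord K j × MvPolynomial (Fin j) K))
    (hDA : ∀ j d', 1 ≤ j → j ≤ m → d' ≤ d → d' ≤ j * (Fintype.card K - 1) →
      PRMDecoding.IsRMDecoder d' j (DA d' j))
    (c e : PRMDecoding.ProjWord K m) (hc : c ∈ PRMDecoding.PRM K d m)
    (he : (hammingNorm e : ℚ) < (PRMDecoding.eta K ν d m : ℚ) / 2) :
    ∃ f : MvPolynomial (Fin (m + 1)) K,
      f.IsHomogeneous d ∧ PRMDecoding.evP f = c ∧
      PRMDecoding.decode ξ DA m d (c + e) = some (c, f) := by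
  obtain ⟨f, hf⟩ := PRMDecoding.exists_decode_eq_some hξ hd hμ hDA hc
    (PRMDecoding.natCast_lt_half_iff.1 he)
  obtain ⟨hhom, hev⟩ := PRMDecoding.decode_sound hξ (by omega) hDA _ _ _ hf
  exact ⟨f, hhom, hev, hf⟩
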